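/- Let $\rho>1/2$, $\epsilon>0$, $t>0$ and $\theta$ be real, let $\mu=\mu_R+i\mu_I\in\mathbb C$ ($\mu_R,\mu_I$ real), let $z=te^{i\theta}$, and let $$E_{\rho,\mu}(z)=\sum_{k=0}^{\infty}\frac{z^k}{\Gamma(\mu+k/\rho)}$$ be the Mittag-Leffler function (the series converges; $1/\Gamma$ is taken to be $0$ at the poles of $\Gamma$). For $r>0$ and $\varphi\in\mathbb R$ put $$f(r,\varphi,t,\theta)=\exp\{(tr)^\rho\cos(\rho(\theta+\varphi))+\rho\mu_I(\theta+\varphi)\},$$ $$\xi(r,\varphi,t,\theta)=(tr)^\rho\sin(\rho(\theta+\varphi))+\rho(1-\mu_R)(\theta+\varphi)-\rho\mu_I\ln(tr),$$ $$P^{Re}_{\rho,\mu}(r,\varphi,t,\theta)=\frac{\rho}{2\pi}\,\frac{(tr)^{\rho(1-\mu_R)}\,r\,f(r,\varphi,t,\theta)}{r^2-2r\cos\varphi+1}\,\bigl(r\cos(\xi(r,\varphi,t,\theta))-\cos(\xi(r,\varphi,t,\theta)+\varphi)\bigr),$$ $$P^{Im}_{\rho,\mu}(r,\varphi,t,\theta)=\frac{\rho}{2\pi}\,\frac{(tr)^{\rho(1-\mu_R)}\,r\,f(r,\varphi,t,\theta)}{r^2-2r\cos\varphi+1}\,\bigl(r\sin(\xi(r,\varphi,t,\theta))-\sin(\xi(r,\varphi,t,\theta)+\varphi)\bigr).$$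 1) Let $\delta_\rho$ be real with $\pi/(2\rho)<\delta_\rho\leqslant\min(\pi,\pi/\rho)$ and suppose that $\frac{\pi}{2\rho}-\delta_\rho+\pi<\theta<-\frac{\pi}{2\rho}+\delta_\rho+\pi$. Then $$E_{\rho,\mu}(z)=\int_{1+\epsilon}^{\infty}K^{Re}_{\rho,\mu}(r,\delta_\rho,t,\theta)\,dr+\int_{-\delta_\rho-\pi}^{\delta_\rho-\pi}P^{Re}_{\rho,\mu}(1+\epsilon,\varphi,t,\theta)\,d\varphi+i\left\{\int_{1+\epsilon}^{\infty}K^{Im}_{\rho,\mu}(r,\delta_\rho,t,\theta)\,dr+\int_{-\delta_\rho-\pi}^{\delta_\rho-\pi}P^{Im}_{\rho,\mu}(1+\epsilon,\varphi,t,\theta)\,d\varphi\right\},$$ where all the integrals converge absolutely and, with $\xi_\pm=\xi(r,\pm\delta_\rho-\pi,t,\theta)$ and $f_\pm=f(r,\pm\delta_\rho-\pi,t,\theta)$, $$K^{Re}_{\rho,\mu}(r,\delta_\rho,t,\theta)=\frac{\rho}{2\pi}\,\frac{(tr)^{\rho(1-\mu_R)}}{r^2+2r\cos\delta_\rho+1}\Bigl[f_+\bigl(r\sin\xi_++\sin(\xi_++\delta_\rho)\bigr)-f_-\bigl(r\sin\xi_-+\sin(\xi_--\delta_\rho)\bigr)\Bigr],$$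 $$K^{Im}_{\rho,\mu}(r,\delta_\rho,t,\theta)=\frac{\rho}{2\pi}\,\frac{(tr)^{\rho(1-\mu_R)}}{r^2+2r\cos\delta_\rho+1}\Bigl[f_-\bigl(r\cos\xi_-+\cos(\xi_--\delta_\rho)\bigr)-f_+\bigl(r\cos\xi_++\cos(\xi_++\delta_\rho)\bigr)\Bigr].$$ 2) Let $\rho\geqslant1$ and $\delta_\rho=\pi/\rho$, and suppose again that $\frac{\pi}{2\rho}-\delta_\rho+\pi<\theta<-\frac{\pi}{2\rho}+\delta_\rho+\pi$. Then $$E_{\rho,\mu}(z)=\int_{1+\epsilon}^{\infty}K^{Re}_{\rho,\mu}(r,t,\theta)\,dr+\int_{-\pi/\rho-\pi}^{\pi/\rho-\pi}P^{Re}_{\rho,\mu}(1+\epsilon,\varphi,t,\theta)\,d\varphi+i\left\{\int_{1+\epsilon}^{\infty}K^{Im}_{\rho,\mu}(r,t,\theta)\,dr+\int_{-\pi/\rho-\pi}^{\pi/\rho-\pi}P^{Im}_{\rho,\mu}(1+\epsilon,\varphi,t,\theta)\,d\varphi\right\},$$ where all the integrals converge absolutely and, with $$\varrho=\varrho(r,t,\theta)=-(tr)^\rho\cos(\rho(\theta-\pi))+\rho\mu_I(\theta-\pi),$$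 $$\xi'=\xi'(r,t,\theta)=-(tr)^\rho\sin(\rho(\theta-\pi))+\rho(1-\mu_R)(\theta-\pi)-\rho\mu_I\ln(tr)$$ and $\xi'_\pm=\xi'\pm(1-\mu_R)\pi$, $$K^{Re}_{\rho,\mu}(r,t,\theta)=\frac{\rho}{2\pi}\,\frac{(tr)^{\rho(1-\mu_R)}e^{\varrho}}{r^2+2r\cos(\pi/\rho)+1}\Bigl[e^{\mu_I\pi}\bigl(r\sin\xi'_++\sin(\xi'_++\pi/\rho)\bigr)-e^{-\mu_I\pi}\bigl(r\sin\xi'_-+\sin(\xi'_--\pi/\rho)\bigr)\Bigr],$$ $$K^{Im}_{\rho,\mu}(r,t,\theta)=\frac{\rho}{2\pi}\,\frac{(tr)^{\rho(1-\mu_R)}e^{\varrho}}{r^2+2r\cos(\pi/\rho)+1}\Bigl[e^{-\mu_I\pi}\bigl(r\cos\xi'_-+\cos(\xi'_--\pi/\rho)\bigr)-e^{\mu_I\pi}\bigl(r\cos\xi'_++\cos(\xi'_++\pi/\rho)\bigr)\Bigr].$$ -/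

import Mathlib

open MeasureTheory Set

noncomputable section

/-- The `k`-th term `z ^ k / Γ(μ + k / ρ)` of the Mittag-Leffler series. At the poles of `Γ`,
where `1 / Γ` vanishes, Mathlib's convention `Γ = 0`, `x / 0 = 0` gives the right value `0`. -/
def mittagLefflerTerm (ρ : ℝ) (μ z : ℂ) (k : ℕ) : ℂ :=
  z ^ k / Complex.Gamma (μ + (k : ℂ) / (ρ : ℂ))

/-- The two-parameter Mittag-Leffler function `E_{ρ,μ}(z) = ∑ z ^ k / Γ(μ + k / ρ)`. -/
def mittagLeffler (ρ : ℝ) (μ z : ℂ) : ℂ :=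
  ∑' k : ℕ, mittagLefflerTerm ρ μ z k

/-- `f(r, φ, t, θ)`. -/
def mlF (ρ : ℝ) (μ : ℂ) (r φ t θ : ℝ) : ℝ :=
  Real.exp ((t * r) ^ ρ * Real.cos (ρ * (θ + φ)) + ρ * μ.im * (θ + φ))

/-- `ξ(r, φ, t, θ)`. -/
def mlXi (ρ : ℝ) (μ : ℂ) (r φ t θ : ℝ) : ℝ :=
  (t * r) ^ ρ * Real.sin (ρ * (θ + φ)) + ρ * (1 - μ.re) * (θ + φ)
    - ρ * μ.im * Real.log (t * r)

/-- `P^{Re}(r, φ, t, θ)`. -/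
def mlPRe (ρ : ℝ) (μ : ℂ) (r φ t θ : ℝ) : ℝ :=
  ρ / (2 * Real.pi) *
    ((t * r) ^ (ρ * (1 - μ.re)) * r * mlF ρ μ r φ t θ / (r ^ 2 - 2 * r * Real.cos φ + 1)) *
    (r * Real.cos (mlXi ρ μ r φ t θ) - Real.cos (mlXi ρ μ r φ t θ + φ))

/-- `P^{Im}(r, φ, t, θ)`. -/
def mlPIm (ρ : ℝ) (μ : ℂ) (r φ t θ : ℝ) : ℝ :=
  ρ / (2 * Real.pi) *
    ((t * r) ^ (ρ * (1 - μ.re)) * r * mlF ρ μ r φ t θ / (r ^ 2 - 2 * r * Real.cos φ + 1)) *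
    (r * Real.sin (mlXi ρ μ r φ t θ) - Real.sin (mlXi ρ μ r φ t θ + φ))

/-- The symmetric kernel `K^{Re}(r, δ, t, θ)`. -/
def mlKRe (ρ : ℝ) (μ : ℂ) (r δ t θ : ℝ) : ℝ :=
  ρ / (2 * Real.pi) *
    ((t * r) ^ (ρ * (1 - μ.re)) / (r ^ 2 + 2 * r * Real.cos δ + 1)) *
    (mlF ρ μ r (δ - Real.pi) t θ *
        (r * Real.sin (mlXi ρ μ r (δ - Real.pi) t θ)
          + Real.sin (mlXi ρ μ r (δ - Real.pi) t θ + δ))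
      - mlF ρ μ r (-δ - Real.pi) t θ *
        (r * Real.sin (mlXi ρ μ r (-δ - Real.pi) t θ)
          + Real.sin (mlXi ρ μ r (-δ - Real.pi) t θ - δ)))

/-- The symmetric kernel `K^{Im}(r, δ, t, θ)`. -/
def mlKIm (ρ : ℝ) (μ : ℂ) (r δ t θ : ℝ) : ℝ :=
  ρ / (2 * Real.pi) *
    ((t * r) ^ (ρ * (1 - μ.re)) / (r ^ 2 + 2 * r * Real.cos δ + 1)) *
    (mlF ρ μ r (-δ - Real.pi) t θ *
        (r * Real.cos (mlXi ρ μ r (-δ - Real.pi) t θ)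
          + Real.cos (mlXi ρ μ r (-δ - Real.pi) t θ - δ))
      - mlF ρ μ r (δ - Real.pi) t θ *
        (r * Real.cos (mlXi ρ μ r (δ - Real.pi) t θ)
          + Real.cos (mlXi ρ μ r (δ - Real.pi) t θ + δ)))

/-- `ϱ(r, t, θ)`. -/
def mlVarrho (ρ : ℝ) (μ : ℂ) (r t θ : ℝ) : ℝ :=
  -(t * r) ^ ρ * Real.cos (ρ * (θ - Real.pi)) + ρ * μ.im * (θ - Real.pi)

/-- `ξ'(r, t, θ)`. -/
def mlXi' (ρ : ℝ) (μ : ℂ) (r t θ : ℝ) : ℝ :=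
  -(t * r) ^ ρ * Real.sin (ρ * (θ - Real.pi)) + ρ * (1 - μ.re) * (θ - Real.pi)
    - ρ * μ.im * Real.log (t * r)

/-- The kernel `K^{Re}(r, t, θ)` of the case `δ = π / ρ`. -/
def mlKRePi (ρ : ℝ) (μ : ℂ) (r t θ : ℝ) : ℝ :=
  ρ / (2 * Real.pi) *
    ((t * r) ^ (ρ * (1 - μ.re)) * Real.exp (mlVarrho ρ μ r t θ)
      / (r ^ 2 + 2 * r * Real.cos (Real.pi / ρ) + 1)) *
    (Real.exp (μ.im * Real.pi) *
        (r * Real.sin (mlXi' ρ μ r t θ + (1 - μ.re) * Real.pi)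
          + Real.sin (mlXi' ρ μ r t θ + (1 - μ.re) * Real.pi + Real.pi / ρ))
      - Real.exp (-μ.im * Real.pi) *
        (r * Real.sin (mlXi' ρ μ r t θ - (1 - μ.re) * Real.pi)
          + Real.sin (mlXi' ρ μ r t θ - (1 - μ.re) * Real.pi - Real.pi / ρ)))

/-- The kernel `K^{Im}(r, t, θ)` of the case `δ = π / ρ`. -/
def mlKImPi (ρ : ℝ) (μ : ℂ) (r t θ : ℝ) : ℝ :=
  ρ / (2 * Real.pi) *
    ((t * r) ^ (ρ * (1 - μ.re)) * Real.exp (mlVarrho ρ μ r t θ)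
      / (r ^ 2 + 2 * r * Real.cos (Real.pi / ρ) + 1)) *
    (Real.exp (-μ.im * Real.pi) *
        (r * Real.cos (mlXi' ρ μ r t θ - (1 - μ.re) * Real.pi)
          + Real.cos (mlXi' ρ μ r t θ - (1 - μ.re) * Real.pi - Real.pi / ρ))
      - Real.exp (μ.im * Real.pi) *
        (r * Real.cos (mlXi' ρ μ r t θ + (1 - μ.re) * Real.pi)
          + Real.cos (mlXi' ρ μ r t θ + (1 - μ.re) * Real.pi + Real.pi / ρ)))

end

/-! The starting point is Hankel's formula: `1 / Γ(ν)` is `1 / (2πi)` times the integral of `e^u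
u^(-ν)` over a contour around the negative axis. With `u = e^s` the integrand becomes the entire
function `exp (e^s + (1 - ν) s)`, so no branch of a power has to be chosen. The contour becomes
three sides of a half-strip, and its horizontal ends may lie wherever `cos (Im s) < 0`, where the
integrand decays doubly exponentially.

Hankel's formula (`hankelIntegral_eq`) is proved by deforming the contour. For `Re ν < 1` and ends
on `Im s = ±π`, the vertical side is pushed to `Re s = -∞`; the rays then give Euler's integral for
`Γ(1 - ν)`, and the reflection formula finishes. A recurrence in `ν`, obtained by integrating a
derivative, removes the bound on `Re ν`.

Multiplying the kernel by `(z e^(-s/ρ))^k` shifts `μ` to `μ + k/ρ`. When `|z e^(-s/ρ)| ≤ q < 1` on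
the contour, the geometric series may be summed under the integral (`hasSum_mittagLefflerTerm`),
which represents `E_{ρ,μ}(z)` by the kernel divided by `1 - z e^(-s/ρ)`.

Finally `s = ρ log (t r) + i ρ (θ + φ)`, that is `e^(s/ρ) = z r e^(iφ)`. The vertical side is the
arc `r = 1 + ε` and gives `P`; the two ends are the rays `φ = ±δ - π` and together give `K`. The
condition on `θ` places the ends where the kernel decays. -/

/-! ### Hankel's kernel and its decay -/

/-- The integrand of Hankel's representation of `1 / Γ(ν)` in the logarithmic coordinate. -/
noncomputable def hankelKernel (ν s : ℂ) : ℂ := Complex.exp (Complex.exp s + (1 - ν) * s)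

/-- The integral of `g` along the contour that comes from infinity along `Im s = a`, turns at
`Re s = c` and returns to infinity along `Im s = b`. -/
noncomputable def hankelIntegral (g : ℂ → ℂ) (c a b : ℝ) : ℂ :=
  Complex.I * (∫ y in a..b, g (c + y * Complex.I)) + (∫ x in Ioi c, g (x + b * Complex.I))
    - ∫ x in Ioi c, g (x + a * Complex.I)

theorem differentiable_hankelKernel (ν : ℂ) : Differentiable ℂ (hankelKernel ν) := by
  unfold hankelKernel; fun_prop

theorem continuous_hankelKernel (ν : ℂ) : Continuous (hankelKernel ν) :=
  (differentiable_hankelKernel ν).continuous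

theorem norm_hankelKernel (ν : ℂ) (x y : ℝ) :
    ‖hankelKernel ν (x + y * Complex.I)‖ =
      Real.exp (Real.exp x * Real.cos y + (1 - ν.re) * x + ν.im * y) := by
  unfold hankelKernel
  rw [Complex.norm_exp]
  congr 1
  simp [Complex.exp_re, add_assoc]

/-- Exponential growth beats linear growth. Comparison with `-x` is enough both for integrability
and for the limit at infinity. -/
theorem eventually_exp_lower (κ σ : ℝ) (hκ : 0 < κ) :
    ∀ᶠ x : ℝ in Filter.atTop, -κ * Real.exp x + σ * x ≤ -x := by
  have h := (Real.tendsto_exp_div_pow_atTop 1).eventually_ge_atTop ((σ + 1) / κ)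
  filter_upwards [h, Filter.eventually_gt_atTop 0] with x hx h0
  rw [pow_one, div_le_div_iff₀ hκ h0] at hx
  linarith

theorem integrableOn_exp_neg_exp (κ σ c : ℝ) (hκ : 0 < κ) :
    IntegrableOn (fun x : ℝ => Real.exp (-κ * Real.exp x + σ * x)) (Ioi c) := by
  refine integrable_of_isBigO_exp_neg one_pos (by fun_prop) ?_
  refine Asymptotics.IsBigO.of_bound 1 ?_
  filter_upwards [eventually_exp_lower κ σ hκ] with x hx
  simpa using hx

theorem tendsto_exp_neg_exp (κ σ : ℝ) (hκ : 0 < κ) :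
    Filter.Tendsto (fun x : ℝ => Real.exp (-κ * Real.exp x + σ * x)) Filter.atTop (nhds 0) := by
  refine Real.tendsto_exp_atBot.comp ?_
  exact Filter.tendsto_atBot_mono' _ (eventually_exp_lower κ σ hκ) Filter.tendsto_neg_atTop_atBot

theorem norm_hankelKernel_le (ν : ℂ) {κ x y : ℝ} (h : Real.cos y ≤ -κ) :
    ‖hankelKernel ν (x + y * Complex.I)‖ ≤
      Real.exp (-κ * Real.exp x + (1 - ν.re) * x) * Real.exp (ν.im * y) := by
  rw [norm_hankelKernel, ← Real.exp_add, Real.exp_le_exp]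
  nlinarith [Real.exp_pos x]

theorem integrableOn_hankelKernel (ν : ℂ) (c : ℝ) {b : ℝ} (hb : Real.cos b < 0) :
    IntegrableOn (fun x : ℝ => hankelKernel ν (x + b * Complex.I)) (Ioi c) := by
  refine ((integrableOn_exp_neg_exp (-Real.cos b) (1 - ν.re) c (by linarith)).mul_const
    (Real.exp (ν.im * b))).mono' ?_ (Filter.Eventually.of_forall fun x =>
      norm_hankelKernel_le ν (by simp))
  exact ((continuous_hankelKernel ν).comp (by fun_prop)).aestronglyMeasurable

theorem tendsto_hankelKernel (ν : ℂ) {b : ℝ} (hb : Real.cos b < 0) :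
    Filter.Tendsto (fun x : ℝ => hankelKernel ν (x + b * Complex.I)) Filter.atTop (nhds 0) := by
  have h := (tendsto_exp_neg_exp (-Real.cos b) (1 - ν.re) (by linarith)).mul_const
    (Real.exp (ν.im * b))
  rw [zero_mul] at h
  exact squeeze_zero_norm (fun x => norm_hankelKernel_le ν (by simp)) h

/-! ### Deformation of the contour -/

theorem rectangle_integral_eq_zero {g : ℂ → ℂ} (hg : Differentiable ℂ g) (x₁ x₂ y₁ y₂ : ℝ) :
    (∫ x in x₁..x₂, g (x + y₁ * Complex.I)) - (∫ x in x₁..x₂, g (x + y₂ * Complex.I))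
      + Complex.I * (∫ y in y₁..y₂, g (x₂ + y * Complex.I))
      - Complex.I * (∫ y in y₁..y₂, g (x₁ + y * Complex.I)) = 0 := by
  have := Complex.integral_boundary_rect_eq_zero_of_differentiableOn g ⟨x₁, y₁⟩ ⟨x₂, y₂⟩
    hg.differentiableOn
  simpa using this

/-- Cauchy's theorem for the half-strip to the right of `Re s = c`. -/
theorem halfStrip_hankelKernel (ν : ℂ) (c y₁ y₂ : ℝ) (h : ∀ y ∈ uIcc y₁ y₂, Real.cos y < 0) :
    (∫ x in Ioi c, hankelKernel ν (x + y₁ * Complex.I))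
      - (∫ x in Ioi c, hankelKernel ν (x + y₂ * Complex.I))
      = Complex.I * ∫ y in y₁..y₂, hankelKernel ν (c + y * Complex.I) := by
  -- Compactness makes the decay uniform in `y`: `cos m < 0` is the largest cosine on the far side
  -- of the rectangle, and `M` maximises the remaining factor. Hence that side contributes nothing
  -- in the limit.
  obtain ⟨m, hm, hmax⟩ := isCompact_uIcc.exists_isMaxOn nonempty_uIcc
    (Real.continuous_cos.continuousOn (s := uIcc y₁ y₂))
  obtain ⟨M, -, hM⟩ := isCompact_uIcc.exists_isMaxOn nonempty_uIcc
    ((show Continuous fun y : ℝ => Real.exp (ν.im * y) by fun_prop).continuousOn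
      (s := uIcc y₁ y₂))
  have hside : Filter.Tendsto (fun X : ℝ => Complex.I *
      ∫ y in y₁..y₂, hankelKernel ν (X + y * Complex.I)) Filter.atTop (nhds 0) := by
    have ht := ((tendsto_exp_neg_exp (-Real.cos m) (1 - ν.re)
      (by linarith [h m hm])).mul_const (Real.exp (ν.im * M))).mul_const |y₂ - y₁|
    rw [zero_mul, zero_mul] at ht
    refine squeeze_zero_norm (fun X => ?_) ht
    rw [norm_mul, Complex.norm_I, one_mul]
    refine intervalIntegral.norm_integral_le_of_norm_le_const fun y hy => ?_
    have hy' := uIoc_subset_uIcc hy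
    refine (norm_hankelKernel_le ν (κ := -Real.cos m) (by simpa using hmax hy')).trans ?_
    exact mul_le_mul_of_nonneg_left (hM hy') (Real.exp_pos _).le
  have h1 := intervalIntegral_tendsto_integral_Ioi c
    (integrableOn_hankelKernel ν c (h y₁ left_mem_uIcc)) Filter.tendsto_id
  have h2 := intervalIntegral_tendsto_integral_Ioi c
    (integrableOn_hankelKernel ν c (h y₂ right_mem_uIcc)) Filter.tendsto_id
  have h3 := ((h1.sub h2).add hside).sub_const
    (Complex.I * ∫ y in y₁..y₂, hankelKernel ν (c + y * Complex.I))
  have h4 := tendsto_nhds_unique (h3.congr fun X =>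
    rectangle_integral_eq_zero (differentiable_hankelKernel ν) c X y₁ y₂) tendsto_const_nhds
  linear_combination h4

theorem intervalIntegrable_hankelKernel_vertical (ν : ℂ) (c a b : ℝ) :
    IntervalIntegrable (fun y : ℝ => hankelKernel ν (c + y * Complex.I)) volume a b :=
  ((continuous_hankelKernel ν).comp (by fun_prop)).intervalIntegrable _ _

theorem hankelIntegral_congr_ends (ν : ℂ) (c : ℝ) {a b a' b' : ℝ}
    (ha : ∀ y ∈ uIcc a a', Real.cos y < 0) (hb : ∀ y ∈ uIcc b b', Real.cos y < 0) :
    hankelIntegral (hankelKernel ν) c a b = hankelIntegral (hankelKernel ν) c a' b' := by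
  have h1 := halfStrip_hankelKernel ν c a a' ha
  have h2 := halfStrip_hankelKernel ν c b b' hb
  have i := intervalIntegrable_hankelKernel_vertical ν c
  have h3 := intervalIntegral.integral_add_adjacent_intervals (i a a') (i a' b)
  have h4 := intervalIntegral.integral_add_adjacent_intervals (i a' b) (i b b')
  unfold hankelIntegral
  rw [← h3, ← h4]
  linear_combination h2 - h1

theorem hankelIntegral_congr_start (ν : ℂ) (c c' : ℝ) {a b : ℝ}
    (ha : Real.cos a < 0) (hb : Real.cos b < 0) :
    hankelIntegral (hankelKernel ν) c a b = hankelIntegral (hankelKernel ν) c' a b := by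
  have h := rectangle_integral_eq_zero (differentiable_hankelKernel ν) c c' a b
  have ia := intervalIntegral.integral_interval_add_Ioi (b := c')
    (integrableOn_hankelKernel ν c ha) (integrableOn_hankelKernel ν c' ha)
  have ib := intervalIntegral.integral_interval_add_Ioi (b := c')
    (integrableOn_hankelKernel ν c hb) (integrableOn_hankelKernel ν c' hb)
  unfold hankelIntegral
  rw [← ia, ← ib]
  linear_combination -h

/-! ### Evaluation of Hankel's integral -/

/-- The derivative of the kernel with parameter `ν + 1` is the kernel for `ν` minus `ν` times
itself. Its integral over the contour vanishes: the values at the corners cancel and those at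
infinity are zero. -/
theorem hankelIntegral_recurrence (ν : ℂ) (c : ℝ) {a b : ℝ}
    (ha : Real.cos a < 0) (hb : Real.cos b < 0) :
    hankelIntegral (hankelKernel ν) c a b =
      ν * hankelIntegral (hankelKernel (ν + 1)) c a b := by
  have hd : ∀ s, HasDerivAt (hankelKernel (ν + 1))
      (hankelKernel ν s - ν * hankelKernel (ν + 1) s) s := by
    intro s
    have h1 := ((Complex.hasDerivAt_exp s).add
      ((hasDerivAt_id s).const_mul (1 - (ν + 1)))).cexp
    refine h1.congr_deriv ?_
    have : hankelKernel ν s = Complex.exp s * hankelKernel (ν + 1) s := by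
      unfold hankelKernel
      rw [← Complex.exp_add]; ring_nf
    rw [this]
    simp only [hankelKernel, id, Pi.add_apply]
    ring
  have hray : ∀ y : ℝ, Real.cos y < 0 →
      (∫ x in Ioi c, hankelKernel ν (x + y * Complex.I))
        - ν * (∫ x in Ioi c, hankelKernel (ν + 1) (x + y * Complex.I))
        = -hankelKernel (ν + 1) (c + y * Complex.I) := by
    intro y hy
    have i1 := integrableOn_hankelKernel ν c hy
    have i2 := (integrableOn_hankelKernel (ν + 1) c hy).const_mul ν
    rw [← integral_const_mul, ← integral_sub i1 i2, ← zero_sub]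
    refine integral_Ioi_of_hasDerivAt_of_tendsto' (fun x _ => ?_) (i1.sub i2)
      (tendsto_hankelKernel (ν + 1) hy)
    have := (hd (x + y * Complex.I)).comp (x : ℂ)
      ((hasDerivAt_id (x : ℂ)).add_const (y * Complex.I))
    simpa using this.comp_ofReal
  have hvert : Complex.I * (∫ y in a..b, hankelKernel ν (c + y * Complex.I))
      - ν * (Complex.I * ∫ y in a..b, hankelKernel (ν + 1) (c + y * Complex.I))
      = hankelKernel (ν + 1) (c + b * Complex.I) - hankelKernel (ν + 1) (c + a * Complex.I) := by
    have i1 := (intervalIntegrable_hankelKernel_vertical ν c a b).const_mul Complex.I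
    have i2 := ((intervalIntegrable_hankelKernel_vertical (ν + 1) c a b).const_mul
      Complex.I).const_mul ν
    rw [← intervalIntegral.integral_const_mul, ← intervalIntegral.integral_const_mul,
      ← intervalIntegral.integral_const_mul, ← intervalIntegral.integral_sub i1 i2]
    refine intervalIntegral.integral_eq_sub_of_hasDerivAt
      (f := fun y : ℝ => hankelKernel (ν + 1) (c + y * Complex.I)) (fun y _ => ?_) (i1.sub i2)
    have := (hd (c + y * Complex.I)).comp (y : ℂ)
      (((hasDerivAt_id (y : ℂ)).mul_const Complex.I).const_add (c : ℂ))
    refine this.comp_ofReal.congr_deriv ?_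
    ring
  unfold hankelIntegral
  linear_combination hvert + hray b hb - hray a ha

/-- Euler's integral under the substitution `u = e^x`. -/
theorem integral_exp_exp_line {s : ℂ} (hs : 0 < s.re) :
    Integrable (fun x : ℝ => Complex.exp (-Complex.exp x + s * x)) ∧
      ∫ x : ℝ, Complex.exp (-Complex.exp x + s * x) = Complex.Gamma s := by
  have himg : Real.exp '' univ = Ioi 0 := by rw [image_univ, Real.range_exp]
  have hcongr : ∀ x : ℝ, |Real.exp x| • (((-Real.exp x).exp : ℂ) * (Real.exp x : ℂ) ^ (s - 1))
      = Complex.exp (-Complex.exp x + s * x) := by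
    intro x
    rw [abs_of_pos (Real.exp_pos x), Complex.real_smul,
      Complex.cpow_def_of_ne_zero (by exact_mod_cast (Real.exp_pos x).ne'),
      ← Complex.ofReal_log (Real.exp_pos x).le, Real.log_exp]
    push_cast
    rw [← Complex.exp_add, ← Complex.exp_add]
    ring_nf
  have hd : ∀ x ∈ (univ : Set ℝ), HasDerivWithinAt Real.exp (Real.exp x) univ x :=
    fun x _ => (Real.hasDerivAt_exp x).hasDerivWithinAt
  have hi := Complex.GammaIntegral_convergent hs
  constructor
  · rw [← himg, integrableOn_image_iff_integrableOn_abs_deriv_smul MeasurableSet.univ hd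
      Real.exp_injective.injOn, integrableOn_univ] at hi
    exact hi.congr (Filter.Eventually.of_forall fun x => by simpa using hcongr x)
  · rw [Complex.Gamma_eq_integral hs, Complex.GammaIntegral, ← himg,
      integral_image_eq_integral_abs_deriv_smul MeasurableSet.univ hd Real.exp_injective.injOn,
      Measure.restrict_univ]
    exact integral_congr_ae (Filter.Eventually.of_forall fun x => by simpa using (hcongr x).symm)

theorem hankelKernel_add_pi_mul_I (ν : ℂ) (x : ℝ) :
    hankelKernel ν (x + Real.pi * Complex.I) =
      Complex.exp (-Complex.exp x + (1 - ν) * x) * Complex.exp ((1 - ν) * (Real.pi * Complex.I)) := by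
  unfold hankelKernel
  rw [Complex.exp_add (x : ℂ), Complex.exp_pi_mul_I, ← Complex.exp_add]
  ring_nf

theorem hankelKernel_sub_pi_mul_I (ν : ℂ) (x : ℝ) :
    hankelKernel ν (x + (-Real.pi : ℝ) * Complex.I) =
      Complex.exp (-Complex.exp x + (1 - ν) * x) * Complex.exp (-((1 - ν) * (Real.pi * Complex.I))) := by
  unfold hankelKernel
  have : Complex.exp ((-Real.pi : ℝ) * Complex.I) = -1 := by
    push_cast; rw [neg_mul, Complex.exp_neg, Complex.exp_pi_mul_I]; norm_num
  rw [Complex.exp_add (x : ℂ), this, ← Complex.exp_add]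
  push_cast
  ring_nf

theorem two_I_sin_mul_Gamma_one_sub {ν : ℂ} (hν : ν.re < 1) :
    (Complex.exp ((1 - ν) * (Real.pi * Complex.I))
      - Complex.exp (-((1 - ν) * (Real.pi * Complex.I)))) * Complex.Gamma (1 - ν)
      = 2 * Real.pi * Complex.I / Complex.Gamma ν := by
  have hΓ : Complex.Gamma (1 - ν) ≠ 0 := Complex.Gamma_ne_zero_of_re_pos (by simpa using hν)
  have hsin : Complex.exp ((1 - ν) * (Real.pi * Complex.I))
      - Complex.exp (-((1 - ν) * (Real.pi * Complex.I)))
      = 2 * Complex.I * Complex.sin (Real.pi * ν) := by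
    have h := Complex.two_sin (Real.pi * (1 - ν))
    have h' : Complex.sin (Real.pi * (1 - ν)) = Complex.sin (Real.pi * ν) := by
      rw [mul_sub, mul_one, Complex.sin_pi_sub]
    rw [h'] at h
    rw [show (1 - ν) * (Real.pi * Complex.I) = Real.pi * (1 - ν) * Complex.I by ring, ← neg_mul]
    linear_combination Complex.I * (-1) * h
      + (Complex.exp (Real.pi * (1 - ν) * Complex.I)
        - Complex.exp (-(Real.pi * (1 - ν)) * Complex.I)) * Complex.I_mul_I
  have hrefl := Complex.Gamma_mul_Gamma_one_sub ν
  have hpi : (Real.pi : ℂ) ≠ 0 := by exact_mod_cast Real.pi_ne_zero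
  rw [hsin]
  -- At a pole the convention gives `Γ(ν) = 0`, and the reflection formula then forces `sin (π ν) =
  -- 0`, so both sides vanish.
  by_cases h0 : Complex.Gamma ν = 0
  · rw [h0, zero_mul, eq_comm, div_eq_zero_iff] at hrefl
    rw [h0, div_zero, hrefl.resolve_left hpi]
    simp
  · have hs : Complex.sin (Real.pi * ν) ≠ 0 := by
      intro h
      rw [h, div_zero] at hrefl
      exact mul_ne_zero h0 hΓ hrefl
    rw [eq_div_iff hs] at hrefl
    rw [eq_div_iff h0]
    linear_combination 2 * Complex.I * hrefl

theorem cos_pi_neg' : Real.cos (-Real.pi) < 0 := by simp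

theorem cos_pi_neg : Real.cos Real.pi < 0 := by simp

/-- The value does not depend on `c`, so it can be computed as `c → -∞`. The vertical side is of
order `e^((1 - Re ν) c)` and disappears because `Re ν < 1`. On the rays `e^s = -e^x`, so both carry
the integrand of `Γ(1 - ν)`, with opposite phases. -/
theorem hankelIntegral_pi_of_re_lt_one {ν : ℂ} (hν : ν.re < 1) (c : ℝ) :
    hankelIntegral (hankelKernel ν) c (-Real.pi) Real.pi
      = 2 * Real.pi * Complex.I / Complex.Gamma ν := by
  obtain ⟨hint, hval⟩ := integral_exp_exp_line (s := 1 - ν) (by simpa using hν)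
  have hray : Filter.Tendsto (fun X : ℝ => ∫ x in Ioi X,
      Complex.exp (-Complex.exp x + (1 - ν) * x)) Filter.atBot (nhds (Complex.Gamma (1 - ν))) := by
    rw [← hval]
    exact (aecover_Ioi Filter.tendsto_id).integral_tendsto_of_countably_generated hint
  have hvert : Filter.Tendsto (fun X : ℝ => Complex.I *
      ∫ y in (-Real.pi)..Real.pi, hankelKernel ν (X + y * Complex.I)) Filter.atBot (nhds 0) := by
    have ht : Filter.Tendsto (fun X : ℝ => Real.exp (Real.exp X + (1 - ν.re) * X
        + |ν.im| * Real.pi) * |Real.pi - -Real.pi|) Filter.atBot (nhds 0) := by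
      rw [← zero_mul |Real.pi - -Real.pi|]
      refine Filter.Tendsto.mul_const _ (Real.tendsto_exp_atBot.comp ?_)
      refine Filter.tendsto_atBot_add_const_right _ _ ?_
      exact Real.tendsto_exp_atBot.add_atBot
        (Filter.tendsto_id.const_mul_atBot (by linarith))
    refine squeeze_zero_norm (fun X => ?_) ht
    rw [norm_mul, Complex.norm_I, one_mul]
    refine intervalIntegral.norm_integral_le_of_norm_le_const fun y hy => ?_
    rw [uIoc_of_le (by linarith [Real.pi_pos])] at hy
    rw [norm_hankelKernel, Real.exp_le_exp]
    have h1 : ν.im * y ≤ |ν.im| * Real.pi := by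
      refine (le_abs_self _).trans ?_
      rw [abs_mul]
      exact mul_le_mul_of_nonneg_left (abs_le.2 ⟨hy.1.le, hy.2⟩) (abs_nonneg _)
    have h2 := mul_le_mul_of_nonneg_left (Real.cos_le_one y) (Real.exp_pos X).le
    linarith
  have hlim := hvert.add (hray.mul_const (Complex.exp ((1 - ν) * (Real.pi * Complex.I))
      - Complex.exp (-((1 - ν) * (Real.pi * Complex.I)))))
  rw [zero_add, mul_comm (Complex.Gamma _), two_I_sin_mul_Gamma_one_sub hν] at hlim
  refine (tendsto_nhds_unique (hlim.congr fun X => ?_) tendsto_const_nhds).symm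
  rw [hankelIntegral_congr_start ν c X cos_pi_neg' cos_pi_neg, hankelIntegral]
  simp_rw [hankelKernel_add_pi_mul_I, hankelKernel_sub_pi_mul_I]
  rw [integral_mul_const, integral_mul_const]
  ring

/-- The recurrence from `0` to `1` has factor `0` and says nothing here, so `ν = 1` needs its own
argument. The kernel is then `2πi`-periodic: the rays cancel, and the vertical side is the circle
integral of `e^u / u`. -/
theorem hankelIntegral_pi_one (c : ℝ) :
    hankelIntegral (hankelKernel 1) c (-Real.pi) Real.pi = 2 * Real.pi * Complex.I := by
  have h := Complex.circleIntegral_sub_inv_smul_of_differentiable_on_off_countable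
    (R := Real.exp c) (w := 0) (c := 0) (f := Complex.exp) countable_empty
    (by simp [Real.exp_pos]) Complex.continuous_exp.continuousOn
    (fun z _ => Complex.differentiable_exp z)
  have hfun : ∀ y : ℝ, deriv (circleMap 0 (Real.exp c)) y •
      ((circleMap 0 (Real.exp c) y - 0)⁻¹ • Complex.exp (circleMap 0 (Real.exp c) y))
      = Complex.I * hankelKernel 1 (c + y * Complex.I) := by
    intro y
    have hne : circleMap 0 (Real.exp c) y ≠ 0 := by simp [circleMap, Complex.exp_ne_zero]
    rw [deriv_circleMap, sub_zero, smul_eq_mul, smul_eq_mul]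
    field_simp
    simp [hankelKernel, circleMap, Complex.exp_add, mul_comm]
  have hper : Function.Periodic
      (fun y : ℝ => Complex.I * hankelKernel 1 (c + y * Complex.I)) (2 * Real.pi) := by
    intro y
    have hp := periodic_circleMap 0 (Real.exp c) y
    simp only [← hfun, deriv_circleMap, hp]
  rw [circleIntegral] at h
  simp_rw [hfun] at h
  -- Periodicity moves the parametrisation of the circle from `[0, 2π]` to `[-π, π]`.
  have hshift := hper.intervalIntegral_add_eq 0 (-Real.pi)
  rw [zero_add, show -Real.pi + 2 * Real.pi = Real.pi by ring] at hshift
  rw [hshift, intervalIntegral.integral_const_mul] at h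
  unfold hankelIntegral
  rw [h]
  simp_rw [hankelKernel_add_pi_mul_I, hankelKernel_sub_pi_mul_I]
  simp

/-- Hankel's integral for the contour with both ends on the lines `Im s = ±π`. -/
theorem hankelIntegral_pi (ν : ℂ) (c : ℝ) :
    hankelIntegral (hankelKernel ν) c (-Real.pi) Real.pi
      = 2 * Real.pi * Complex.I / Complex.Gamma ν := by
  -- The induction widens the half-plane of admissible `ν` by one unit at a time.
  suffices H : ∀ (n : ℕ) (ν : ℂ), ν.re < 1 + n →
      hankelIntegral (hankelKernel ν) c (-Real.pi) Real.pi
        = 2 * Real.pi * Complex.I / Complex.Gamma ν by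
    obtain ⟨n, hn⟩ := exists_nat_gt (ν.re - 1)
    exact H n ν (by linarith)
  intro n
  induction n with
  | zero => exact fun ν h => hankelIntegral_pi_of_re_lt_one (by simpa using h) c
  | succ n ih =>
    intro ν h
    by_cases h1 : ν = 1
    · rw [h1, hankelIntegral_pi_one, Complex.Gamma_one, div_one]
    · have h0 : ν - 1 ≠ 0 := sub_ne_zero.2 h1
      have hr := hankelIntegral_recurrence (ν - 1) c cos_pi_neg' cos_pi_neg
      have hg := Complex.Gamma_add_one (ν - 1) h0
      rw [sub_add_cancel] at hr hg
      have hi := ih (ν - 1) (by push_cast at h; simp; linarith)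
      rw [hr] at hi
      rw [hg, ← mul_right_inj' h0, hi, mul_div_assoc', mul_div_mul_left _ _ h0]

/-- Hankel's formula for `1 / Γ(ν)`, with ends in the directions of decay. -/
theorem hankelIntegral_eq (ν : ℂ) (c : ℝ) {a b : ℝ}
    (ha : a ∈ Ioo (-(3 * Real.pi / 2)) (-(Real.pi / 2)))
    (hb : b ∈ Ioo (Real.pi / 2) (3 * Real.pi / 2)) :
    hankelIntegral (hankelKernel ν) c a b = 2 * Real.pi * Complex.I / Complex.Gamma ν := by
  rw [← hankelIntegral_pi ν c]
  have hpi := Real.pi_pos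
  have hcos : ∀ y ∈ Ioo (Real.pi / 2) (3 * Real.pi / 2), Real.cos y < 0 := fun y hy =>
    Real.cos_neg_of_pi_div_two_lt_of_lt hy.1 (by linarith [hy.2])
  refine hankelIntegral_congr_ends ν c (fun y hy => ?_) (fun y hy => ?_)
  · rw [← Real.cos_neg]
    have := ordConnected_Ioo.uIcc_subset ha (show -Real.pi ∈ Ioo _ _ by
      constructor <;> linarith) hy
    exact hcos _ ⟨by linarith [this.2], by linarith [this.1]⟩
  · exact hcos _ (ordConnected_Ioo.uIcc_subset hb (show Real.pi ∈ Ioo _ _ by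
      constructor <;> linarith) hy)

/-! ### Summation of the series under the integral -/

/-- The `k`-th term is dominated by `q^k ‖F‖`, so the integrals of the norms are summable; the
quotient is dominated by `‖F‖ / (1 - q)`. -/
theorem hasSum_integral_geometric {α : Type*} [MeasurableSpace α] {m : Measure α} {F w : α → ℂ}
    {q : ℝ} (hF : Integrable F m) (hw : AEStronglyMeasurable w m) (hq : q < 1)
    (hwq : ∀ᵐ x ∂m, ‖w x‖ ≤ q) :
    Integrable (fun x => F x / (1 - w x)) m ∧
      HasSum (fun k : ℕ => ∫ x, F x * w x ^ k ∂m) (∫ x, F x / (1 - w x) ∂m) := by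
  -- That `q ≥ 0` is read off at a point where the bound holds, and such a point exists only for a
  -- nonzero measure.
  rcases eq_or_ne m 0 with rfl | hm
  · simp
  have : (ae m).NeBot := ae_neBot.2 hm
  obtain ⟨x₀, hx₀⟩ := hwq.exists
  have hq0 : 0 ≤ q := (norm_nonneg _).trans hx₀
  have hnorm : ∀ k : ℕ, ∀ᵐ x ∂m, ‖F x * w x ^ k‖ ≤ ‖F x‖ * q ^ k := fun k => by
    filter_upwards [hwq] with x hx
    rw [norm_mul, norm_pow]
    gcongr
  have hint : ∀ k : ℕ, Integrable (fun x => F x * w x ^ k) m := fun k =>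
    (hF.norm.mul_const (q ^ k)).mono' (hF.aestronglyMeasurable.mul (hw.pow k)) (hnorm k)
  have htsum : (fun x => ∑' k : ℕ, F x * w x ^ k) =ᵐ[m] fun x => F x / (1 - w x) := by
    filter_upwards [hwq] with x hx
    rw [tsum_mul_left, tsum_geometric_of_norm_lt_one (hx.trans_lt hq), div_eq_mul_inv]
  constructor
  · refine (hF.norm.mul_const (1 - q)⁻¹).mono' ?_ ?_
    · simp_rw [div_eq_mul_inv]
      exact hF.aestronglyMeasurable.mul
        (aestronglyMeasurable_const.sub hw).aemeasurable.inv.aestronglyMeasurable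
    · filter_upwards [hwq] with x hx
      rw [norm_div, div_eq_mul_inv]
      have h1 : 1 - q ≤ ‖1 - w x‖ := by
        have := norm_sub_norm_le (1 : ℂ) (w x)
        rw [norm_one] at this
        linarith
      have : 0 < 1 - q := by linarith
      gcongr
  · rw [← integral_congr_ae htsum]
    refine hasSum_integral_of_summable_integral_norm hint ?_
    refine Summable.of_nonneg_of_le (fun k => integral_nonneg fun x => norm_nonneg _) (fun k => ?_)
      ((summable_geometric_of_lt_one hq0 hq).mul_left (∫ x, ‖F x‖ ∂m))
    rw [← integral_mul_const]
    exact integral_mono_ae (hint k).norm (hF.norm.mul_const _) (hnorm k)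

/-- The integrand of the contour representation of `E_{ρ,μ}(z)` in the logarithmic coordinate. -/
noncomputable def mittagLefflerKernel (ρ : ℝ) (μ z s : ℂ) : ℂ :=
  hankelKernel μ s / (1 - z * Complex.exp (-s / ρ))

/-- This turns each term of the geometric series into a Hankel integrand for `1 / Γ(μ + k/ρ)`. -/
theorem hankelKernel_mul_pow (ρ : ℝ) (μ z s : ℂ) (k : ℕ) :
    hankelKernel μ s * (z * Complex.exp (-s / ρ)) ^ k
      = z ^ k * hankelKernel (μ + (k : ℂ) / (ρ : ℂ)) s := by
  unfold hankelKernel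
  rw [mul_pow, ← Complex.exp_nat_mul, mul_left_comm, ← Complex.exp_add]
  ring_nf

theorem norm_mul_exp_neg_div_le (ρ : ℝ) (hρ : 0 < ρ) (z : ℂ) {c x : ℝ} (hx : c ≤ x) (y : ℝ) :
    ‖z * Complex.exp (-(x + y * Complex.I) / ρ)‖ ≤ ‖z‖ * Real.exp (-c / ρ) := by
  rw [norm_mul, Complex.norm_exp]
  have : (-(x + y * Complex.I) / ρ : ℂ).re = -x / ρ := by
    rw [Complex.div_ofReal_re]; simp
  rw [this]
  gcongr

/-- The contour representation of the Mittag-Leffler function, with the integrability of the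
integrand on the three parts of the contour. -/
theorem hasSum_mittagLefflerTerm (ρ : ℝ) (hρ : 0 < ρ) (μ z : ℂ) {a b c : ℝ}
    (hz : ‖z‖ * Real.exp (-c / ρ) < 1)
    (ha : a ∈ Ioo (-(3 * Real.pi / 2)) (-(Real.pi / 2)))
    (hb : b ∈ Ioo (Real.pi / 2) (3 * Real.pi / 2)) :
    IntegrableOn (fun x : ℝ => mittagLefflerKernel ρ μ z (x + a * Complex.I)) (Ioi c) ∧
    IntegrableOn (fun x : ℝ => mittagLefflerKernel ρ μ z (x + b * Complex.I)) (Ioi c) ∧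
    IntervalIntegrable (fun y : ℝ => mittagLefflerKernel ρ μ z (c + y * Complex.I)) volume a b ∧
    HasSum (mittagLefflerTerm ρ μ z)
      (hankelIntegral (mittagLefflerKernel ρ μ z) c a b / (2 * Real.pi * Complex.I)) := by
  have hpi := Real.pi_pos
  have hcb : Real.cos b < 0 :=
    Real.cos_neg_of_pi_div_two_lt_of_lt hb.1 (by linarith [hb.2])
  have hca : Real.cos a < 0 := by
    rw [← Real.cos_neg]
    exact Real.cos_neg_of_pi_div_two_lt_of_lt (by linarith [ha.2]) (by linarith [ha.1])
  have hab : a ≤ b := by linarith [ha.2, hb.1]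
  have hray : ∀ y : ℝ, Real.cos y < 0 → _ := fun y hy =>
    hasSum_integral_geometric (integrableOn_hankelKernel μ c hy)
      (w := fun x : ℝ => z * Complex.exp (-(x + y * Complex.I) / ρ))
      (by fun_prop) hz
      (ae_restrict_of_forall_mem measurableSet_Ioi fun x hx =>
        norm_mul_exp_neg_div_le ρ hρ z (le_of_lt hx) y)
  have hvert := hasSum_integral_geometric
    ((intervalIntegrable_iff_integrableOn_Ioc_of_le hab).1
      (intervalIntegrable_hankelKernel_vertical μ c a b))
    (w := fun y : ℝ => z * Complex.exp (-(c + y * Complex.I) / ρ))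
    (by fun_prop) hz
    (Filter.Eventually.of_forall fun y => norm_mul_exp_neg_div_le ρ hρ z le_rfl y)
  refine ⟨(hray a hca).1, (hray b hcb).1,
    (intervalIntegrable_iff_integrableOn_Ioc_of_le hab).2 hvert.1, ?_⟩
  have hsum := ((((hvert.2.mul_left Complex.I).add (hray b hcb).2).sub (hray a hca).2).div_const
    (2 * Real.pi * Complex.I))
  have hpi0 : (2 * Real.pi * Complex.I : ℂ) ≠ 0 := by
    simp [Real.pi_ne_zero]
  convert! hsum using 1
  · funext k
    have h := hankelIntegral_eq (μ + (k : ℂ) / (ρ : ℂ)) c ha hb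
    simp_rw [hankelKernel_mul_pow, integral_const_mul]
    rw [hankelIntegral, intervalIntegral.integral_of_le hab] at h
    rw [mittagLefflerTerm, eq_div_iff hpi0]
    linear_combination -z ^ k * h
  · rw [hankelIntegral, intervalIntegral.integral_of_le hab]
    rfl

/-! ### Polar coordinates and real and imaginary parts -/

theorem image_mul_log_Ioi {ρ t R : ℝ} (hρ : 0 < ρ) (ht : 0 < t) (hR : 0 < R) :
    (fun r => ρ * Real.log (t * r)) '' Ioi R = Ioi (ρ * Real.log (t * R)) := by
  ext x
  constructor
  · rintro ⟨r, hr, rfl⟩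
    exact mul_lt_mul_of_pos_left
      (Real.log_lt_log (by positivity) (mul_lt_mul_of_pos_left hr ht)) hρ
  · intro hx
    refine ⟨Real.exp (x / ρ) / t, ?_, ?_⟩
    · rw [mem_Ioi, lt_div_iff₀ ht, ← Real.log_lt_iff_lt_exp (by positivity), lt_div_iff₀ hρ]
      simpa [mul_comm] using hx
    · simp only
      rw [mul_div_cancel₀ _ ht.ne', Real.log_exp, mul_div_cancel₀ _ hρ.ne']

theorem integral_Ioi_mul_log {ρ t R : ℝ} (hρ : 0 < ρ) (ht : 0 < t) (hR : 0 < R) (g : ℝ → ℂ) :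
    (IntegrableOn g (Ioi (ρ * Real.log (t * R))) →
      IntegrableOn (fun r => (ρ / r : ℝ) * g (ρ * Real.log (t * r))) (Ioi R)) ∧
    ∫ x in Ioi (ρ * Real.log (t * R)), g x
      = ∫ r in Ioi R, (ρ / r : ℝ) * g (ρ * Real.log (t * r)) := by
  have hd : ∀ r ∈ Ioi R, HasDerivWithinAt (fun r => ρ * Real.log (t * r)) (ρ / r) (Ioi R) r := by
    intro r hr
    have hr0 : 0 < r := hR.trans hr
    have := ((((hasDerivAt_id r).const_mul t).log (mul_pos ht hr0).ne').const_mul ρ)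
    refine (this.congr_deriv ?_).hasDerivWithinAt
    simp only [id]
    field_simp
  have hinj : InjOn (fun r => ρ * Real.log (t * r)) (Ioi R) := by
    intro r hr r' hr' h
    have h1 : (0 : ℝ) < r := hR.trans hr
    have h2 : (0 : ℝ) < r' := hR.trans hr'
    have := Real.log_injOn_pos (mem_Ioi.2 (mul_pos ht h1)) (mem_Ioi.2 (mul_pos ht h2))
      (mul_left_cancel₀ hρ.ne' h)
    exact mul_left_cancel₀ ht.ne' this
  have habs : ∀ r ∈ Ioi R, |ρ / r| • g (ρ * Real.log (t * r))
      = (ρ / r : ℝ) * g (ρ * Real.log (t * r)) := by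
    intro r hr
    rw [abs_of_pos (div_pos hρ (hR.trans hr)), Complex.real_smul]
  rw [← image_mul_log_Ioi hρ ht hR,
    integrableOn_image_iff_integrableOn_abs_deriv_smul measurableSet_Ioi hd hinj,
    integral_image_eq_integral_abs_deriv_smul measurableSet_Ioi hd hinj]
  exact ⟨fun h => h.congr_fun habs measurableSet_Ioi,
    setIntegral_congr_fun measurableSet_Ioi habs⟩

theorem integral_re_add_I_mul_im {α : Type*} [MeasurableSpace α] {m : Measure α} {F : α → ℂ}
    {u v : α → ℝ} (hF : Integrable F m) (h : ∀ᵐ x ∂m, F x = u x + Complex.I * v x) :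
    Integrable u m ∧ Integrable v m ∧
      ∫ x, F x ∂m = ((∫ x, u x ∂m : ℝ) : ℂ) + Complex.I * ((∫ x, v x ∂m : ℝ) : ℂ) := by
  have hu : Integrable u m := hF.re.congr (by filter_upwards [h] with x hx; simp [hx])
  have hv : Integrable v m := hF.im.congr (by filter_upwards [h] with x hx; simp [hx])
  refine ⟨hu, hv, ?_⟩
  rw [integral_congr_ae h, integral_add hu.ofReal (hv.ofReal.const_mul _), integral_const_mul,
    integral_complex_ofReal, integral_complex_ofReal]

/-- Here `1 - z e^(-s/ρ) = (r - e^(-iφ)) / r`. Extending the fraction by `r - e^(iφ)` makes the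
denominator `r² - 2 r cos φ + 1`, which is positive as `r > 1`, and puts `e^(iξ) (r - e^(iφ))` in
the numerator. -/
theorem mittagLefflerKernel_polar {ρ r t : ℝ} (hρ : 0 < ρ) (hr : 1 < r) (ht : 0 < t) (μ : ℂ)
    (φ θ : ℝ) :
    mittagLefflerKernel ρ μ (t * Complex.exp (Complex.I * θ))
        ((ρ * Real.log (t * r) : ℝ) + (ρ * (θ + φ) : ℝ) * Complex.I)
      = ((t * r) ^ (ρ * (1 - μ.re)) * r * mlF ρ μ r φ t θ / (r ^ 2 - 2 * r * Real.cos φ + 1) : ℝ)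
        * ((r * Real.cos (mlXi ρ μ r φ t θ) - Real.cos (mlXi ρ μ r φ t θ + φ) : ℝ)
          + Complex.I *
            (r * Real.sin (mlXi ρ μ r φ t θ) - Real.sin (mlXi ρ μ r φ t θ + φ) : ℝ)) := by
  have hr0 : 0 < r := by linarith
  have htr : 0 < t * r := by positivity
  set ξ := mlXi ρ μ r φ t θ with hξ
  have hD : 0 < r ^ 2 - 2 * r * Real.cos φ + 1 := by
    nlinarith [Real.cos_le_one φ, sq_pos_of_pos (sub_pos.2 hr)]
  have hk : hankelKernel μ ((ρ * Real.log (t * r) : ℝ) + (ρ * (θ + φ) : ℝ) * Complex.I)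
      = ((t * r) ^ (ρ * (1 - μ.re)) * mlF ρ μ r φ t θ : ℝ) * Complex.exp (Complex.I * ξ) := by
    have h1 : Real.exp (ρ * Real.log (t * r)) = (t * r) ^ ρ := by
      rw [Real.rpow_def_of_pos htr, mul_comm]
    have h2 : (t * r) ^ (ρ * (1 - μ.re)) = Real.exp (ρ * (1 - μ.re) * Real.log (t * r)) := by
      rw [Real.rpow_def_of_pos htr, mul_comm]
    rw [hankelKernel, h2, mlF, ← Real.exp_add, Complex.ofReal_exp, ← Complex.exp_add,
      Complex.exp_add (ρ * Real.log (t * r) : ℝ), ← Complex.ofReal_exp, h1, Complex.exp_mul_I,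
      ← Complex.ofReal_cos, ← Complex.ofReal_sin]
    congr 1
    apply Complex.ext
    · simp [-Complex.ofReal_cos, -Complex.ofReal_sin]; ring
    · simp [hξ, mlXi, -Complex.ofReal_cos, -Complex.ofReal_sin]; ring
  have hw : (t * Complex.exp (Complex.I * θ)) * Complex.exp
      (-((ρ * Real.log (t * r) : ℝ) + (ρ * (θ + φ) : ℝ) * Complex.I) / ρ)
      = (r : ℂ)⁻¹ * Complex.exp (-(φ * Complex.I)) := by
    have hρ' : (ρ : ℂ) ≠ 0 := by exact_mod_cast hρ.ne'
    have h1 : (-((ρ * Real.log (t * r) : ℝ) + (ρ * (θ + φ) : ℝ) * Complex.I) / ρ : ℂ)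
        = -(Real.log (t * r) : ℂ) + (-(θ + φ) * Complex.I) := by
      push_cast; field_simp; ring
    rw [h1, Complex.exp_add, Complex.exp_neg, ← Complex.ofReal_exp, Real.exp_log htr,
      show (-(φ * Complex.I) : ℂ) = Complex.I * θ + (-(θ + φ) * Complex.I) by ring,
      Complex.exp_add]
    have ht' : (t : ℂ) ≠ 0 := by exact_mod_cast ht.ne'
    push_cast
    field_simp
  have hr' : (r : ℂ) ≠ 0 := by exact_mod_cast hr0.ne'
  have hD' : ((r ^ 2 - 2 * r * Real.cos φ + 1 : ℝ) : ℂ) ≠ 0 := by exact_mod_cast hD.ne'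
  set e := Complex.exp (φ * Complex.I) with he
  have he0 : e ≠ 0 := Complex.exp_ne_zero _
  have hcos : ((r ^ 2 - 2 * r * Real.cos φ + 1 : ℝ) : ℂ) = (r - e) * (r - e⁻¹) := by
    have := Complex.two_cos φ
    rw [neg_mul, Complex.exp_neg, ← he] at this
    push_cast
    have h3 := mul_inv_cancel₀ he0
    linear_combination (-r : ℂ) * this - h3
  have hne : (r : ℂ) - e⁻¹ ≠ 0 := by
    intro h; rw [hcos, h, mul_zero] at hD'; exact hD' rfl
  have hnum : ((r * Real.cos ξ - Real.cos (ξ + φ) : ℝ) : ℂ)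
      + Complex.I * (r * Real.sin ξ - Real.sin (ξ + φ) : ℝ)
      = Complex.exp (Complex.I * ξ) * (r - e) := by
    rw [mul_sub, he, ← Complex.exp_add,
      show Complex.I * (ξ : ℂ) + φ * Complex.I = ((ξ + φ : ℝ) : ℂ) * Complex.I by push_cast; ring,
      mul_comm Complex.I (ξ : ℂ), Complex.exp_mul_I, Complex.exp_mul_I]
    push_cast
    ring
  have hne' : (r : ℂ) - e ≠ 0 := by
    intro h; rw [hcos, h, zero_mul] at hD'; exact hD' rfl
  have hne2 : (1 : ℂ) - (r : ℂ)⁻¹ * e⁻¹ ≠ 0 := by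
    intro h
    apply hne
    have := congrArg (fun x => (r : ℂ) * x) h
    simpa [mul_sub, hr'] using this
  rw [mittagLefflerKernel, hk, hw, Complex.exp_neg, ← he, hnum, Complex.ofReal_div, hcos,
    div_mul_eq_mul_div, div_eq_div_iff hne2 (mul_ne_zero hne' hne)]
  push_cast
  have h4 := mul_inv_cancel₀ hr'
  linear_combination (-((t * r) ^ (ρ * (1 - μ.re)) : ℝ) : ℂ) * mlF ρ μ r φ t θ
    * Complex.exp (Complex.I * ξ) * (r - e) * (-e⁻¹) * h4

theorem summable_mittagLefflerTerm {ρ : ℝ} (hρ : 0 < ρ) (μ z : ℂ) :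
    Summable (mittagLefflerTerm ρ μ z) := by
  have hz : 0 < ‖z‖ + 1 := by positivity
  have hpi := Real.pi_pos
  -- Any admissible contour proves convergence; this `c` makes the ratio at most `‖z‖ / (‖z‖ + 1)`.
  refine (hasSum_mittagLefflerTerm ρ hρ μ z (c := ρ * Real.log (‖z‖ + 1)) (a := -Real.pi)
    (b := Real.pi) ?_ ⟨by linarith, by linarith⟩ ⟨by linarith, by linarith⟩).2.2.2.summable
  rw [neg_div, mul_div_cancel_left₀ _ hρ.ne', Real.exp_neg, Real.exp_log hz, ← div_eq_mul_inv,
    div_lt_one hz]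
  linarith

theorem mlP_eq_mittagLefflerKernel {ρ r t : ℝ} (hρ : 0 < ρ) (hr : 1 < r) (ht : 0 < t) (μ : ℂ)
    (φ θ : ℝ) :
    (ρ / (2 * Real.pi) : ℝ) * mittagLefflerKernel ρ μ (t * Complex.exp (Complex.I * θ))
        ((ρ * Real.log (t * r) : ℝ) + (ρ * (θ + φ) : ℝ) * Complex.I)
      = mlPRe ρ μ r φ t θ + Complex.I * mlPIm ρ μ r φ t θ := by
  rw [mittagLefflerKernel_polar hρ hr ht, mlPRe, mlPIm]
  push_cast
  ring

/-- The Jacobian `ρ / r` cancels the factor `r` of the polar form, and the shift by `-π` turns `-cos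
φ` into `cos δ`. Division by `i` is why sines appear in the real kernel and cosines in the imaginary
one. -/
theorem mlK_eq_mittagLefflerKernel {ρ r t : ℝ} (hρ : 0 < ρ) (hr : 1 < r) (ht : 0 < t) (μ : ℂ)
    (δ θ : ℝ) :
    ((ρ / r : ℝ) * mittagLefflerKernel ρ μ (t * Complex.exp (Complex.I * θ))
        ((ρ * Real.log (t * r) : ℝ) + (ρ * (θ + (δ - Real.pi)) : ℝ) * Complex.I)
      - (ρ / r : ℝ) * mittagLefflerKernel ρ μ (t * Complex.exp (Complex.I * θ))
        ((ρ * Real.log (t * r) : ℝ) + (ρ * (θ + (-δ - Real.pi)) : ℝ) * Complex.I))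
        / (2 * Real.pi * Complex.I)
      = mlKRe ρ μ r δ t θ + Complex.I * mlKIm ρ μ r δ t θ := by
  have hr0 : r ≠ 0 := by linarith
  have hr' : (r : ℂ) ≠ 0 := by exact_mod_cast hr0
  have hpi : (Real.pi : ℂ) ≠ 0 := by exact_mod_cast Real.pi_ne_zero
  rw [mittagLefflerKernel_polar hρ hr ht, mittagLefflerKernel_polar hρ hr ht, mlKRe, mlKIm,
    ← add_sub_assoc, ← add_sub_assoc, Real.cos_sub_pi, Real.cos_sub_pi, Real.cos_sub_pi,
    Real.cos_sub_pi, Real.sin_sub_pi, Real.sin_sub_pi, Real.cos_neg, ← sub_eq_add_neg,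
    mul_neg, sub_neg_eq_add]
  set ξ₁ := mlXi ρ μ r (δ - Real.pi) t θ
  set ξ₂ := mlXi ρ μ r (-δ - Real.pi) t θ
  set D := r ^ 2 + 2 * r * Real.cos δ + 1
  set A := (t * r) ^ (ρ * (1 - μ.re))
  set f₁ := mlF ρ μ r (δ - Real.pi) t θ
  set f₂ := mlF ρ μ r (-δ - Real.pi) t θ
  rw [div_eq_iff (by simp [Real.pi_ne_zero])]
  simp only [div_eq_mul_inv]
  generalize D⁻¹ = d
  push_cast
  field_simp
  ring_nf
  simp only [Complex.I_sq]
  ring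

/-! ### The integral representation -/

/-- The contour representation of the Mittag-Leffler function along two rays and an arc. -/
theorem mittagLeffler_eq_integral_mlK_add_mlP {ρ ε t θ δ : ℝ} (μ : ℂ) (hρ : 0 < ρ) (hε : 0 < ε)
    (ht : 0 < t) (hδ : δ ≤ Real.pi / ρ)
    (h₁ : Real.pi / (2 * ρ) - δ + Real.pi < θ) (h₂ : θ < -(Real.pi / (2 * ρ)) + δ + Real.pi) :
    IntegrableOn (fun r => mlKRe ρ μ r δ t θ) (Ioi (1 + ε)) ∧
    IntegrableOn (fun r => mlKIm ρ μ r δ t θ) (Ioi (1 + ε)) ∧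
    IntervalIntegrable (fun φ => mlPRe ρ μ (1 + ε) φ t θ) volume (-δ - Real.pi) (δ - Real.pi) ∧
    IntervalIntegrable (fun φ => mlPIm ρ μ (1 + ε) φ t θ) volume (-δ - Real.pi) (δ - Real.pi) ∧
    HasSum (mittagLefflerTerm ρ μ (t * Complex.exp (Complex.I * θ)))
      ((((∫ r in Ioi (1 + ε), mlKRe ρ μ r δ t θ)
          + (∫ φ in (-δ - Real.pi)..(δ - Real.pi), mlPRe ρ μ (1 + ε) φ t θ) : ℝ) : ℂ)
        + Complex.I *
          (((∫ r in Ioi (1 + ε), mlKIm ρ μ r δ t θ)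
            + (∫ φ in (-δ - Real.pi)..(δ - Real.pi), mlPIm ρ μ (1 + ε) φ t θ) : ℝ) : ℂ)) := by
  have hR : 0 < 1 + ε := by linarith
  have htR : 0 < t * (1 + ε) := mul_pos ht hR
  set z : ℂ := t * Complex.exp (Complex.I * θ) with hz
  set c := ρ * Real.log (t * (1 + ε)) with hc
  set a := ρ * (θ + (-δ - Real.pi)) with ha
  set b := ρ * (θ + (δ - Real.pi)) with hb
  -- Since `e^(c/ρ) = t (1 + ε)`, the ratio on the arc has modulus `1 / (1 + ε)`.
  have hq : ‖z‖ * Real.exp (-c / ρ) < 1 := by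
    rw [hz, norm_mul, mul_comm Complex.I, Complex.norm_exp_ofReal_mul_I, mul_one,
      Complex.norm_of_nonneg ht.le, hc, neg_div, mul_div_cancel_left₀ _ hρ.ne', Real.exp_neg,
      Real.exp_log htR, ← div_eq_mul_inv, div_lt_one htR]
    nlinarith
  have e1 : ρ * (Real.pi / (2 * ρ)) = Real.pi / 2 := by field_simp
  have e2 : ρ * δ ≤ Real.pi := by rwa [le_div_iff₀ hρ, mul_comm] at hδ
  have h₁' := mul_lt_mul_of_pos_left h₁ hρ
  have h₂' := mul_lt_mul_of_pos_left h₂ hρ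
  -- Multiplied by `ρ`, the bounds on `θ` give `a < -π/2` and `b > π/2`; the outer bounds `±3π/2`
  -- follow by adding `ρ δ ≤ π` twice.
  have hab : a ∈ Ioo (-(3 * Real.pi / 2)) (-(Real.pi / 2)) ∧
      b ∈ Ioo (Real.pi / 2) (3 * Real.pi / 2) := by
    rw [ha, hb]
    refine ⟨⟨?_, ?_⟩, ?_, ?_⟩ <;> nlinarith
  obtain ⟨ia, ib, iv, hs⟩ := hasSum_mittagLefflerTerm ρ hρ μ z hq hab.1 hab.2
  obtain ⟨ia', ea⟩ := integral_Ioi_mul_log hρ ht hR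
    (fun x : ℝ => mittagLefflerKernel ρ μ z (x + a * Complex.I))
  obtain ⟨ib', eb⟩ := integral_Ioi_mul_log hρ ht hR
    (fun x : ℝ => mittagLefflerKernel ρ μ z (x + b * Complex.I))
  specialize ia' ia
  specialize ib' ib
  have hle : -δ - Real.pi ≤ δ - Real.pi := by nlinarith [hab.1.2, hab.2.1, Real.pi_pos]
  obtain ⟨kr, ki, ke⟩ := integral_re_add_I_mul_im ((ib'.sub ia').div_const (2 * Real.pi * Complex.I))
    (ae_restrict_of_forall_mem measurableSet_Ioi fun r hr =>
      mlK_eq_mittagLefflerKernel hρ (show 1 < r from lt_trans (by linarith) hr) ht μ δ θ)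
  have iv' : IntervalIntegrable (fun φ : ℝ => mittagLefflerKernel ρ μ z
      (c + (ρ * (θ + φ) : ℝ) * Complex.I)) volume (-δ - Real.pi) (δ - Real.pi) := by
    have h := (iv.comp_mul_left (c := ρ)).comp_add_left θ
    rw [ha, hb, mul_div_cancel_left₀ _ hρ.ne', mul_div_cancel_left₀ _ hρ.ne', add_sub_cancel_left,
      add_sub_cancel_left] at h
    exact h
  have ev : ∫ y in a..b, mittagLefflerKernel ρ μ z (c + y * Complex.I)
      = ρ * ∫ φ in (-δ - Real.pi)..(δ - Real.pi), mittagLefflerKernel ρ μ z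
        (c + (ρ * (θ + φ) : ℝ) * Complex.I) := by
    have h := intervalIntegral.smul_integral_comp_mul_add (a := -δ - Real.pi) (b := δ - Real.pi)
      (fun y : ℝ => mittagLefflerKernel ρ μ z (c + y * Complex.I)) ρ (ρ * θ)
    rw [Complex.real_smul] at h
    rw [ha, hb, mul_add, mul_add, add_comm (ρ * θ), add_comm (ρ * θ), ← h]
    simp_rw [mul_add, add_comm (ρ * θ)]
  obtain ⟨pr, pi, pe⟩ := integral_re_add_I_mul_im
    (((intervalIntegrable_iff_integrableOn_Ioc_of_le hle).1 iv').const_mul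
      ((ρ / (2 * Real.pi) : ℝ) : ℂ))
    (Filter.Eventually.of_forall fun φ =>
      mlP_eq_mittagLefflerKernel hρ (show 1 < 1 + ε by linarith) ht μ φ θ)
  refine ⟨kr, ki, (intervalIntegrable_iff_integrableOn_Ioc_of_le hle).2 pr,
    (intervalIntegrable_iff_integrableOn_Ioc_of_le hle).2 pi, ?_⟩
  convert hs using 1
  rw [hankelIntegral, ev, ea, eb]
  rw [integral_div] at ke
  have hsub := integral_sub ib' ia'
  simp only [Pi.sub_apply] at ke
  rw [hsub] at ke
  rw [integral_const_mul] at pe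
  simp only [← intervalIntegral.integral_of_le hle] at pe
  have hpi0 : (2 * Real.pi * Complex.I : ℂ) ≠ 0 := by simp [Real.pi_ne_zero]
  have hpi1 : (Real.pi : ℂ) ≠ 0 := by exact_mod_cast Real.pi_ne_zero
  rw [add_sub_assoc, add_div, ke]
  have hI : ∀ J : ℂ, Complex.I * (ρ * J) / (2 * Real.pi * Complex.I)
      = ((ρ / (2 * Real.pi) : ℝ) : ℂ) * J := by
    intro J
    push_cast
    have := Complex.I_ne_zero
    field_simp
  rw [hI, pe]
  push_cast
  ring

/-- Since `ρ δ = π`, the angle `ρ (θ + φ)` on the two rays is `ρ (θ - π) ± π`. Sine and cosine only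
change sign, so `e^ϱ` factors out and the linear terms leave `±(1 - Re μ) π` and `±π Im μ`. -/
theorem mlK_pi_div_eq {ρ : ℝ} (hρ : ρ ≠ 0) (μ : ℂ) (r t θ : ℝ) :
    mlKRe ρ μ r (Real.pi / ρ) t θ = mlKRePi ρ μ r t θ ∧
      mlKIm ρ μ r (Real.pi / ρ) t θ = mlKImPi ρ μ r t θ := by
  have a1 : ρ * (θ + (Real.pi / ρ - Real.pi)) = ρ * (θ - Real.pi) + Real.pi := by
    field_simp; ring
  have a2 : ρ * (θ + (-(Real.pi / ρ) - Real.pi)) = ρ * (θ - Real.pi) - Real.pi := by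
    field_simp; ring
  have x1 : mlXi ρ μ r (Real.pi / ρ - Real.pi) t θ
      = mlXi' ρ μ r t θ + (1 - μ.re) * Real.pi := by
    rw [mlXi, mlXi', mul_right_comm ρ (1 - μ.re) (θ + _), a1, Real.sin_add_pi]; ring
  have x2 : mlXi ρ μ r (-(Real.pi / ρ) - Real.pi) t θ
      = mlXi' ρ μ r t θ - (1 - μ.re) * Real.pi := by
    rw [mlXi, mlXi', mul_right_comm ρ (1 - μ.re) (θ + _), a2, Real.sin_sub_pi]; ring
  have f1 : mlF ρ μ r (Real.pi / ρ - Real.pi) t θ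
      = Real.exp (mlVarrho ρ μ r t θ) * Real.exp (μ.im * Real.pi) := by
    rw [mlF, mlVarrho, mul_right_comm ρ μ.im (θ + _), a1, Real.cos_add_pi, ← Real.exp_add]
    ring_nf
  have f2 : mlF ρ μ r (-(Real.pi / ρ) - Real.pi) t θ
      = Real.exp (mlVarrho ρ μ r t θ) * Real.exp (-μ.im * Real.pi) := by
    rw [mlF, mlVarrho, mul_right_comm ρ μ.im (θ + _), a2, Real.cos_sub_pi, ← Real.exp_add]
    ring_nf
  constructor
  · rw [mlKRe, mlKRePi, x1, x2, f1, f2]; ring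
  · rw [mlKIm, mlKImPi, x1, x2, f1, f2]; ring

theorem corollary1 (ρ ε t θ : ℝ) (μ z : ℂ) (hρ : 1 / 2 < ρ) (hε : 0 < ε) (ht : 0 < t)
    (hz : z = (t : ℂ) * Complex.exp (Complex.I * (θ : ℂ))) :
    -- the series defining the Mittag-Leffler function converges
    Summable (mittagLefflerTerm ρ μ z) ∧
    -- part 1
    (∀ δ : ℝ, Real.pi / (2 * ρ) < δ → δ ≤ min Real.pi (Real.pi / ρ) →
      Real.pi / (2 * ρ) - δ + Real.pi < θ → θ < -(Real.pi / (2 * ρ)) + δ + Real.pi →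
      IntegrableOn (fun r => mlKRe ρ μ r δ t θ) (Ioi (1 + ε)) ∧
      IntegrableOn (fun r => mlKIm ρ μ r δ t θ) (Ioi (1 + ε)) ∧
      IntervalIntegrable (fun φ => mlPRe ρ μ (1 + ε) φ t θ) volume
        (-δ - Real.pi) (δ - Real.pi) ∧
      IntervalIntegrable (fun φ => mlPIm ρ μ (1 + ε) φ t θ) volume
        (-δ - Real.pi) (δ - Real.pi) ∧
      mittagLeffler ρ μ z =
        (((∫ r in Ioi (1 + ε), mlKRe ρ μ r δ t θ)
          + (∫ φ in (-δ - Real.pi)..(δ - Real.pi), mlPRe ρ μ (1 + ε) φ t θ) : ℝ) : ℂ)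
        + Complex.I *
          (((∫ r in Ioi (1 + ε), mlKIm ρ μ r δ t θ)
            + (∫ φ in (-δ - Real.pi)..(δ - Real.pi), mlPIm ρ μ (1 + ε) φ t θ) : ℝ) : ℂ)) ∧
    -- part 2
    (1 ≤ ρ → ∀ δ : ℝ, δ = Real.pi / ρ →
      Real.pi / (2 * ρ) - δ + Real.pi < θ → θ < -(Real.pi / (2 * ρ)) + δ + Real.pi →
      IntegrableOn (fun r => mlKRePi ρ μ r t θ) (Ioi (1 + ε)) ∧
      IntegrableOn (fun r => mlKImPi ρ μ r t θ) (Ioi (1 + ε)) ∧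
      IntervalIntegrable (fun φ => mlPRe ρ μ (1 + ε) φ t θ) volume
        (-(Real.pi / ρ) - Real.pi) (Real.pi / ρ - Real.pi) ∧
      IntervalIntegrable (fun φ => mlPIm ρ μ (1 + ε) φ t θ) volume
        (-(Real.pi / ρ) - Real.pi) (Real.pi / ρ - Real.pi) ∧
      mittagLeffler ρ μ z =
        (((∫ r in Ioi (1 + ε), mlKRePi ρ μ r t θ)
          + (∫ φ in (-(Real.pi / ρ) - Real.pi)..(Real.pi / ρ - Real.pi),
              mlPRe ρ μ (1 + ε) φ t θ) : ℝ) : ℂ)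
        + Complex.I *
          (((∫ r in Ioi (1 + ε), mlKImPi ρ μ r t θ)
            + (∫ φ in (-(Real.pi / ρ) - Real.pi)..(Real.pi / ρ - Real.pi),
                mlPIm ρ μ (1 + ε) φ t θ) : ℝ) : ℂ)) := by
  have hρ0 : 0 < ρ := by linarith
  subst hz
  have key := fun δ => mittagLeffler_eq_integral_mlK_add_mlP (ε := ε) (θ := θ) (δ := δ) μ hρ0 hε ht
  refine ⟨?_, fun δ _ hδ h₁ h₂ => ?_, fun _ δ hδ h₁ h₂ => ?_⟩
  · exact summable_mittagLefflerTerm hρ0 μ _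
  · obtain ⟨k1, k2, p1, p2, hs⟩ := key δ (hδ.trans (min_le_right _ _)) h₁ h₂
    exact ⟨k1, k2, p1, p2, hs.tsum_eq⟩
  · subst hδ
    obtain ⟨k1, k2, p1, p2, hs⟩ := key _ le_rfl h₁ h₂
    simp only [(mlK_pi_div_eq hρ0.ne' μ _ t θ).1, (mlK_pi_div_eq hρ0.ne' μ _ t θ).2] at k1 k2 hs
    exact ⟨k1, k2, p1, p2, hs.tsum_eq⟩
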